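/- Let $L_2(\exp)$ be the language of second order arithmetic (number variables, set variables, $0,1,+,\cdot,<,\in$) with an additional function symbol for exponentiation. $\Sigma^0_0$ formulas have no set quantifiers and only bounded number quantifiers (free number and set variables are allowed), and $\Sigma^0_1$, $\Pi^0_1$, $\Sigma^0_2$ formulas are those of the form $\exists x\,\theta$, $\forall x\,\theta$, $\exists x\,\forall y\,\theta$ with $\theta$ in $\Sigma^0_0$. Let ${\sf RCA}_0^*$ be the theory consisting of the basic arithmetic axioms $n+1\neq 0$; $m+1=n+1\to m=n$; $m+0=m$; $m+(n+1)=(m+n)+1$; $m\cdot 0=0$; $m\cdot(n+1)=m\cdot n+m$; $\neg\, m<0$; $m<n+1\leftrightarrow(m<n\lor m=n)$, the exponentiation axioms $m^0=1$ and $m^{n+1}=m^n\cdot m$, the induction scheme for $\Sigma^0_0$ formulas, and $\Delta^0_1$ comprehension, i.e. $\forall n(\varphi(n)\leftrightarrow\psi(n))\to\exists X\,\forall n(n\in X\leftrightarrow\varphi(n))$ for $\varphi$ in $\Sigma^0_1$ and $\psi$ in $\Pi^0_1$ with $X$ not free in $\varphi$. Let ${\sf I}\Sigma^0_2$ be the scheme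 $(\varphi(0)\land\forall n(\varphi(n)\to\varphi(n+1)))\to\forall n\,\varphi(n)$ for all $\Sigma^0_2$ formulas $\varphi$, and let ${\sf ECT}$ (eventually constant palette tail) be the statement: if $f:\mathbb N\to k$ for some $k\in\mathbb N$ (that is, $f$ takes values less than $k$), then there is a $b\in\mathbb N$ such that for all $x\ge b$ there is a $y>x$ with $f(x)=f(y)$. Here functions are sets of coded ordered pairs, with $(m,n)$ coded by $(m+n)^2+m$. Then ${\sf I}\Sigma^0_2$ and ${\sf ECT}$ are equivalent over ${\sf RCA}_0^*$: ${\sf ECT}$ follows from ${\sf RCA}_0^*+{\sf I}\Sigma^0_2$, and every instance of ${\sf I}\Sigma^0_2$ follows from ${\sf RCA}_0^*+{\sf ECT}$. Here a formula follows from a theory if it is true in all (Henkin) models of the theory, which by the completeness theorem is the same as being provable in it. -/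

import Mathlib

universe u

namespace SOA

/-! ### The two-sorted language `L₂(exp)` of second order arithmetic with exponentiation -/

/-- Numerical terms; number variables are indexed by `ℕ`. -/
inductive Tm : Type
  | var (x : ℕ)
  | zero
  | one
  | add (s t : Tm)
  | mul (s t : Tm)
  | exp (s t : Tm)

/-- Formulas. Number variables and set variables are two separate families, each indexed by `ℕ`.
`allN x`, `exN x` quantify the number variable `x`; `allS X`, `exS X` the set variable `X`. -/
inductive Fml : Type
  | eq (s t : Tm)
  | lt (s t : Tm)
  | mem (t : Tm) (X : ℕ)
  | neg (φ : Fml)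
  | and (φ ψ : Fml)
  | or (φ ψ : Fml)
  | imp (φ ψ : Fml)
  | allN (x : ℕ) (φ : Fml)
  | exN (x : ℕ) (φ : Fml)
  | allS (X : ℕ) (φ : Fml)
  | exS (X : ℕ) (φ : Fml)

/-- The number variable `x` occurs in the term. -/
def Tm.Occurs (x : ℕ) : Tm → Prop
  | .var y => y = x
  | .zero => False
  | .one => False
  | .add s t => s.Occurs x ∨ t.Occurs x
  | .mul s t => s.Occurs x ∨ t.Occurs x
  | .exp s t => s.Occurs x ∨ t.Occurs x

/-- Replace the number variable `x` by the term `r`. -/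
def Tm.subst (x : ℕ) (r : Tm) : Tm → Tm
  | .var y => if y = x then r else .var y
  | .zero => .zero
  | .one => .one
  | .add s t => .add (Tm.subst x r s) (Tm.subst x r t)
  | .mul s t => .mul (Tm.subst x r s) (Tm.subst x r t)
  | .exp s t => .exp (Tm.subst x r s) (Tm.subst x r t)

namespace Fml

def iff (φ ψ : Fml) : Fml := and (imp φ ψ) (imp ψ φ)

/-- `s ≤ t` abbreviates `s < t ∨ s = t`. -/
def le (s t : Tm) : Fml := or (lt s t) (eq s t)

/-- Replace the free occurrences of the number variable `x` by the term `r`. Bound variables are not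
renamed; below only `r = 0` and `r = x + 1` are used, for which no variable can be captured, since a
free occurrence of `x` is never in the scope of a quantifier over `x`. -/
def subst (x : ℕ) (r : Tm) : Fml → Fml
  | eq s t => eq (Tm.subst x r s) (Tm.subst x r t)
  | lt s t => lt (Tm.subst x r s) (Tm.subst x r t)
  | mem t X => mem (Tm.subst x r t) X
  | neg φ => neg (φ.subst x r)
  | and φ ψ => and (φ.subst x r) (ψ.subst x r)
  | or φ ψ => or (φ.subst x r) (ψ.subst x r)
  | imp φ ψ => imp (φ.subst x r) (ψ.subst x r)
  | allN y φ => if y = x then allN y φ else allN y (φ.subst x r)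
  | exN y φ => if y = x then exN y φ else exN y (φ.subst x r)
  | allS X φ => allS X (φ.subst x r)
  | exS X φ => exS X (φ.subst x r)

/-- The set variable `X` occurs free in the formula. -/
def FreeSet (X : ℕ) : Fml → Prop
  | eq _ _ => False
  | lt _ _ => False
  | mem _ Y => Y = X
  | neg φ => φ.FreeSet X
  | and φ ψ => φ.FreeSet X ∨ ψ.FreeSet X
  | or φ ψ => φ.FreeSet X ∨ ψ.FreeSet X
  | imp φ ψ => φ.FreeSet X ∨ ψ.FreeSet X
  | allN _ φ => φ.FreeSet X
  | exN _ φ => φ.FreeSet X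
  | allS Y φ => Y ≠ X ∧ φ.FreeSet X
  | exS Y φ => Y ≠ X ∧ φ.FreeSet X

/-- `Σ⁰₀` formulas of `L₂(exp)`: no set quantifiers (set parameters are allowed), and every number
quantifier is bounded, `∀ x < t` or `∃ x < t` with `x` not occurring in `t`. -/
inductive IsSigma00 : Fml → Prop
  | eq (s t : Tm) : IsSigma00 (eq s t)
  | lt (s t : Tm) : IsSigma00 (lt s t)
  | mem (t : Tm) (X : ℕ) : IsSigma00 (mem t X)
  | neg {φ : Fml} : IsSigma00 φ → IsSigma00 (neg φ)
  | and {φ ψ : Fml} : IsSigma00 φ → IsSigma00 ψ → IsSigma00 (and φ ψ)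
  | or {φ ψ : Fml} : IsSigma00 φ → IsSigma00 ψ → IsSigma00 (or φ ψ)
  | imp {φ ψ : Fml} : IsSigma00 φ → IsSigma00 ψ → IsSigma00 (imp φ ψ)
  | ball {φ : Fml} (x : ℕ) (t : Tm) : ¬ t.Occurs x → IsSigma00 φ →
      IsSigma00 (allN x (imp (lt (.var x) t) φ))
  | bex {φ : Fml} (x : ℕ) (t : Tm) : ¬ t.Occurs x → IsSigma00 φ →
      IsSigma00 (exN x (and (lt (.var x) t) φ))

/-- `∃ x θ` with `θ` in `Σ⁰₀`. -/
def IsSigma01 (φ : Fml) : Prop := ∃ x θ, IsSigma00 θ ∧ φ = exN x θ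

/-- `∀ x θ` with `θ` in `Σ⁰₀`. -/
def IsPi01 (φ : Fml) : Prop := ∃ x θ, IsSigma00 θ ∧ φ = allN x θ

/-- `∃ x ∀ y θ` with `θ` in `Σ⁰₀`. -/
def IsSigma02 (φ : Fml) : Prop := ∃ x y θ, IsSigma00 θ ∧ φ = exN x (allN y θ)

end Fml

/-! ### Structures, truth and logical consequence -/

/-- A (Henkin) structure for `L₂(exp)`: the number variables range over `N`, the set variables over
a nonempty collection `S` of subsets of `N`. -/
structure L2Structure where
  N : Type u
  S : Set (Set N)
  S_nonempty : S.Nonempty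
  zero : N
  one : N
  add : N → N → N
  mul : N → N → N
  exp : N → N → N
  lt : N → N → Prop

namespace L2Structure

variable (M : L2Structure.{u})

/-- Value of a term under an assignment of the number variables. -/
def eval (e : ℕ → M.N) : Tm → M.N
  | .var x => e x
  | .zero => M.zero
  | .one => M.one
  | .add s t => M.add (eval e s) (eval e t)
  | .mul s t => M.mul (eval e s) (eval e t)
  | .exp s t => M.exp (eval e s) (eval e t)

/-- Satisfaction, for assignments `e` of the number variables and `E` of the set variables. -/
def Sat : Fml → (ℕ → M.N) → (ℕ → Set M.N) → Prop
  | .eq s t, e, _ => M.eval e s = M.eval e t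
  | .lt s t, e, _ => M.lt (M.eval e s) (M.eval e t)
  | .mem t X, e, E => M.eval e t ∈ E X
  | .neg φ, e, E => ¬ Sat φ e E
  | .and φ ψ, e, E => Sat φ e E ∧ Sat ψ e E
  | .or φ ψ, e, E => Sat φ e E ∨ Sat ψ e E
  | .imp φ ψ, e, E => Sat φ e E → Sat ψ e E
  | .allN x φ, e, E => ∀ a : M.N, Sat φ (Function.update e x a) E
  | .exN x φ, e, E => ∃ a : M.N, Sat φ (Function.update e x a) E
  | .allS X φ, e, E => ∀ A ∈ M.S, Sat φ e (Function.update E X A)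
  | .exS X φ, e, E => ∃ A ∈ M.S, Sat φ e (Function.update E X A)

/-- A formula is true in `M` if it holds under all assignments of numbers of `M` and sets of `M` to
its free variables, that is, if its universal closure holds in `M`. -/
def IsTrue (φ : Fml) : Prop :=
  ∀ (e : ℕ → M.N) (E : ℕ → Set M.N), (∀ X, E X ∈ M.S) → M.Sat φ e E

/-- `M` is a model of the theory (set of axioms) `T`. -/
def IsModel (T : Set Fml) : Prop := ∀ φ ∈ T, M.IsTrue φ

end L2Structure

/-- `φ` follows from `T`: it is true in all models of `T`. By the completeness theorem this is the
same as provability of `φ` in `T`. -/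
def Entails (T : Set Fml) (φ : Fml) : Prop :=
  ∀ M : L2Structure.{u}, M.IsModel T → M.IsTrue φ

/-- The sets of axioms `A` and `B` are equivalent over the base theory `T`: each axiom of `B`
follows from `T + A`, and each axiom of `A` follows from `T + B`. -/
def EquivalentOver (T A B : Set Fml) : Prop :=
  (∀ φ ∈ B, Entails.{u} (T ∪ A) φ) ∧ (∀ φ ∈ A, Entails.{u} (T ∪ B) φ)

/-! ### The axioms of `RCA₀*`, and `Σ⁰₂` induction -/

section Axioms

open Fml

/-- Basic arithmetic axioms, with `m`, `n` the number variables `0`, `1`. -/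
def basicAxioms : Set Fml :=
  let m : Tm := .var 0
  let n : Tm := .var 1
  { neg (eq (.add n .one) .zero),
    imp (eq (.add m .one) (.add n .one)) (eq m n),
    eq (.add m .zero) m,
    eq (.add m (.add n .one)) (.add (.add m n) .one),
    eq (.mul m .zero) .zero,
    eq (.mul m (.add n .one)) (.add (.mul m n) m),
    neg (lt m .zero),
    iff (lt m (.add n .one)) (or (lt m n) (eq m n)) }

/-- `m ^ 0 = 1` and `m ^ (n + 1) = m ^ n * m`. -/
def expAxioms : Set Fml :=
  let m : Tm := .var 0
  let n : Tm := .var 1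
  { eq (.exp m .zero) .one,
    eq (.exp m (.add n .one)) (.mul (.exp m n) m) }

/-- `(φ(0) ∧ ∀ x (φ(x) → φ(x + 1))) → ∀ x φ(x)`. -/
def inductionAxiom (x : ℕ) (φ : Fml) : Fml :=
  imp (and (φ.subst x .zero) (allN x (imp φ (φ.subst x (.add (.var x) .one))))) (allN x φ)

/-- The induction scheme for `Σ⁰₀` formulas. -/
def ISigma00 : Set Fml := {χ | ∃ x φ, IsSigma00 φ ∧ χ = inductionAxiom x φ}

/-- The induction scheme for `Σ⁰₂` formulas. -/
def ISigma02 : Set Fml := {χ | ∃ x φ, IsSigma02 φ ∧ χ = inductionAxiom x φ}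

/-- `∀ x (φ(x) ↔ ψ(x)) → ∃ X ∀ x (x ∈ X ↔ φ(x))`, for `φ` in `Σ⁰₁` and `ψ` in `Π⁰₁`, where `X` is
not free in `φ`. -/
def delta01Comprehension : Set Fml :=
  {χ | ∃ x X φ ψ, IsSigma01 φ ∧ IsPi01 ψ ∧ ¬ φ.FreeSet X ∧
    χ = imp (allN x (iff φ ψ)) (exS X (allN x (iff (mem (.var x) X) φ)))}

/-- The theory `RCA₀*`. -/
def RCA0Star : Set Fml := basicAxioms ∪ expAxioms ∪ ISigma00 ∪ delta01Comprehension

/-- The usual code `(s + t)² + s` of the ordered pair `(s, t)`. -/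
def pair (s t : Tm) : Tm := .add (.mul (.add s t) (.add s t)) s

/-- The set variable `F` is (the graph of) a function from the numbers to the numbers below
the number variable `0`: every element of `F` is a pair `(x, y)` with `y < k`, and for every `x`
there is exactly one `y` with `(x, y) ∈ F`. The variables `10, …, 13` are bound. -/
def isColoring (F : ℕ) : Fml :=
  let k : Tm := .var 0
  let x : Tm := .var 10
  let y : Tm := .var 11
  let y' : Tm := .var 12
  let z : Tm := .var 13
  and (allN 13 (imp (mem z F) (exN 10 (exN 11 (and (lt y k) (eq z (pair x y)))))))
    (and (allN 10 (exN 11 (mem (pair x y) F)))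
      (allN 10 (allN 11 (allN 12 (imp (and (mem (pair x y) F) (mem (pair x y') F)) (eq y y'))))))

/-- The principle `ECT`: for all `k` and all `f : ℕ → k` there is `b` such that for all `x ≥ b`
there is `y > x` with `f(x) = f(y)`, that is, with `(x, j) ∈ f` and `(y, j) ∈ f` for some `j`. -/
def ECT : Fml :=
  let b : Tm := .var 1
  let x : Tm := .var 2
  let y : Tm := .var 3
  let j : Tm := .var 4
  allN 0 (allS 0 (imp (isColoring 0)
    (exN 1 (allN 2 (imp (le b x)
      (exN 3 (and (lt x y) (exN 4 (and (mem (pair x j) 0) (mem (pair y j) 0))))))))))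

end Axioms

end SOA

/-!
Suppose `IΣ⁰₂`, and let `f : ℕ → k` be such that arbitrarily large `x` carry a colour that does not
recur after `x`. A set of colours that are absent from some point on is coded by the binary digits
of a number `s < 2 ^ k`, and such a code can always be enlarged by adding a further colour. That
some such code is at least `n` is a `Σ⁰₂` property of `n`, which therefore holds for `n = 2 ^ k`, a
contradiction.

Conversely, `ECT` says that from some point on every colour that occurs recurs unboundedly often.
If `P x m` is `Σ⁰₀` and `P x k` holds for all `x`, colour `x` by the least `m` with `P x m`: this
yields least elements of `Π⁰₁` and `Σ⁰₁` sets, and with them bounding. Consequently every `Σ⁰₂`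
property of `n` takes the form that `{u | Q n u}` is bounded, for a `Σ⁰₀` relation `Q`. Colouring
the pairs `(m, u)` with `Q m u` by `m`, for `m ≤ k`, one sees that `{u | Q m u}` is unbounded as
soon as it has an element `u` for which the code of `(m, u)` is large. Below `k` unboundedness is
thus a `Σ⁰₁` property, so it has a least instance, and induction follows.
-/

namespace SOA

open Function Filter

/-! ### Renaming variables -/

/-- Renaming of the number variables of a term. -/
def Tm.rename (f : ℕ → ℕ) : Tm → Tm
  | .var x => .var (f x)
  | .zero => .zero
  | .one => .one
  | .add s t => .add (s.rename f) (t.rename f)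
  | .mul s t => .mul (s.rename f) (t.rename f)
  | .exp s t => .exp (s.rename f) (t.rename f)

theorem Tm.occurs_rename {f : ℕ → ℕ} {x : ℕ} (t : Tm) :
    (t.rename f).Occurs x ↔ ∃ y, t.Occurs y ∧ f y = x := by
  induction t with
  | var y => simp [rename, Occurs]
  | zero | one => simp [rename, Occurs]
  | add s t hs ht | mul s t hs ht | exp s t hs ht =>
    simp only [rename, Occurs, hs, ht, or_and_right, exists_or]

namespace Fml

/-- Renaming of the number variables along `f` and of the set variables along `g`. Bound variables
are renamed as well, so that no capture can occur as long as `f` and `g` are injective. -/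
def rename (f g : ℕ → ℕ) : Fml → Fml
  | eq s t => eq (s.rename f) (t.rename f)
  | lt s t => lt (s.rename f) (t.rename f)
  | mem t X => mem (t.rename f) (g X)
  | neg φ => neg (φ.rename f g)
  | and φ ψ => and (φ.rename f g) (ψ.rename f g)
  | or φ ψ => or (φ.rename f g) (ψ.rename f g)
  | imp φ ψ => imp (φ.rename f g) (ψ.rename f g)
  | allN x φ => allN (f x) (φ.rename f g)
  | exN x φ => exN (f x) (φ.rename f g)
  | allS X φ => allS (g X) (φ.rename f g)
  | exS X φ => exS (g X) (φ.rename f g)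

variable {f g : ℕ → ℕ}

theorem IsSigma00.rename {φ : Fml} (hφ : φ.IsSigma00) (hf : Injective f) :
    (φ.rename f g).IsSigma00 := by
  have not_occurs : ∀ {x : ℕ} {t : Tm}, ¬ t.Occurs x → ¬ (t.rename f).Occurs (f x) := by
    simp [Tm.occurs_rename, hf.eq_iff]
  induction hφ with
  | eq s t => exact .eq _ _
  | lt s t => exact .lt _ _
  | mem t X => exact .mem _ _
  | neg _ ih => exact ih.neg
  | and _ _ ih₁ ih₂ => exact ih₁.and ih₂
  | or _ _ ih₁ ih₂ => exact ih₁.or ih₂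
  | imp _ _ ih₁ ih₂ => exact ih₁.imp ih₂
  | ball x t hx _ ih => exact ih.ball _ _ (not_occurs hx)
  | bex x t hx _ ih => exact ih.bex _ _ (not_occurs hx)

theorem not_freeSet_rename {X : ℕ} (hX : X ∉ Set.range g) (φ : Fml) :
    ¬ (φ.rename f g).FreeSet X := by
  induction φ with
  | mem t Y => exact fun h => hX ⟨Y, h⟩
  | _ => simp_all [rename, FreeSet]

end Fml

namespace L2Structure

variable {M : L2Structure.{u}}

instance : Zero M.N := ⟨M.zero⟩

instance : One M.N := ⟨M.one⟩

instance : Add M.N := ⟨M.add⟩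

instance : Mul M.N := ⟨M.mul⟩

instance : Pow M.N M.N := ⟨M.exp⟩

instance : LT M.N := ⟨M.lt⟩

instance : LE M.N := ⟨fun a b => a < b ∨ a = b⟩

theorem eval_rename (f : ℕ → ℕ) (e : ℕ → M.N) (t : Tm) :
    M.eval e (t.rename f) = M.eval (e ∘ f) t := by
  induction t <;> simp_all [Tm.rename, eval]

theorem sat_rename {f g : ℕ → ℕ} (hf : Injective f) (hg : Injective g) (φ : Fml) (e : ℕ → M.N)
    (E : ℕ → Set M.N) : M.Sat (φ.rename f g) e E ↔ M.Sat φ (e ∘ f) (E ∘ g) := by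
  induction φ generalizing e E <;>
    simp_all [Fml.rename, Sat, eval_rename, update_comp_eq_of_injective]

theorem eval_update_of_not_occurs {t : Tm} {x : ℕ} (hx : ¬ t.Occurs x) (e : ℕ → M.N) (a : M.N) :
    M.eval (update e x a) t = M.eval e t := by
  induction t <;> simp_all [Tm.Occurs, eval]

theorem eval_subst (e : ℕ → M.N) (x : ℕ) (r t : Tm) :
    M.eval e (Tm.subst x r t) = M.eval (update e x (M.eval e r)) t := by
  induction t with
  | var y => by_cases h : y = x <;> simp [Tm.subst, eval, h]
  | _ => simp_all [Tm.subst, eval]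

theorem sat_subst {x : ℕ} {r : Tm} (hr : ∀ y, r.Occurs y → y = x) (φ : Fml) (e : ℕ → M.N)
    (E : ℕ → Set M.N) :
    M.Sat (φ.subst x r) e E ↔ M.Sat φ (update e x (M.eval e r)) E := by
  have update_swap {y : ℕ} (hy : y ≠ x) (e : ℕ → M.N) (a : M.N) :
      update (update e y a) x (M.eval (update e y a) r) =
        update (update e x (M.eval e r)) y a := by
    rw [eval_update_of_not_occurs fun h => hy (hr y h), update_comm hy]
  induction φ generalizing e E with
  | allN y φ ih | exN y φ ih =>
    by_cases hy : y = x
    · subst hy; simp [Fml.subst, Sat]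
    · simp only [Fml.subst, hy, if_false, Sat, ih, update_swap hy]
  | _ => simp_all [Fml.subst, Sat, eval_subst]

theorem sat_inductionAxiom {x : ℕ} {φ : Fml} {e : ℕ → M.N} {E : ℕ → Set M.N} :
    M.Sat (inductionAxiom x φ) e E ↔
      (M.Sat φ (update e x 0) E → (∀ n, M.Sat φ (update e x n) E → M.Sat φ (update e x (n + 1)) E) →
        ∀ n, M.Sat φ (update e x n) E) := by
  have hzero : M.Sat (φ.subst x .zero) e E ↔ M.Sat φ (update e x 0) E :=
    sat_subst (by simp [Tm.Occurs]) φ e E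
  have hsucc (n : M.N) : M.Sat (φ.subst x (.add (.var x) .one)) (update e x n) E ↔
      M.Sat φ (update e x (n + 1)) E := by
    rw [sat_subst (by simp [Tm.Occurs]), update_idem]
    simp only [eval, update_self]
    rfl
  simp only [inductionAxiom, Sat, hzero, hsucc, and_imp]

/-! ### Definability by `Σ⁰₀` formulas with parameters -/

/-- The sequence with the entries of `a` at the even and those of `b` at the odd places. Number
variables are split in this way into arguments and parameters. -/
def interleave {α : Type*} (a b : ℕ → α) : ℕ → α :=
  Sum.elim a b ∘ Equiv.natSumNatEquivNat.symm

section Interleave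

open Equiv

variable {α : Type*}

theorem interleave_natSumNatEquivNat (a b : ℕ → α) (i : ℕ ⊕ ℕ) :
    interleave a b (natSumNatEquivNat i) = Sum.elim a b i :=
  congrArg (Sum.elim a b) (natSumNatEquivNat.symm_apply_apply i)

theorem interleave_even (a b : ℕ → α) (i : ℕ) : interleave a b (2 * i) = a i :=
  interleave_natSumNatEquivNat a b (.inl i)

theorem interleave_odd (a b : ℕ → α) (i : ℕ) : interleave a b (2 * i + 1) = b i :=
  interleave_natSumNatEquivNat a b (.inr i)

theorem interleave_mem {a b : ℕ → α} {s : Set α} (ha : ∀ i, a i ∈ s) (hb : ∀ i, b i ∈ s) (i : ℕ) :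
    interleave a b i ∈ s := by
  obtain ⟨j | j, rfl⟩ := natSumNatEquivNat.surjective i <;> rw [interleave_natSumNatEquivNat]
  exacts [ha j, hb j]

theorem interleave_update (a b : ℕ → α) (i : ℕ) (c : α) :
    interleave (update a i c) b = update (interleave a b) (2 * i) c := by
  rw [interleave, Sum.elim_update_left, update_comp_equiv]
  rfl

theorem exists_interleave_interleave_comp (b c : ℕ → α) : ∃ f g, Injective f ∧ Injective g ∧
    ∀ a, interleave a (interleave b c) ∘ f = interleave a b ∧
      interleave a (interleave b c) ∘ g = interleave a c := by
  let ν := natSumNatEquivNat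
  have inj {h : ℕ → ℕ} (hh : Injective h) : Injective (ν ∘ Sum.map id h ∘ ν.symm) :=
    ν.injective.comp ((injective_id.sumMap hh).comp ν.symm.injective)
  refine ⟨ν ∘ Sum.map id (2 * ·) ∘ ν.symm, ν ∘ Sum.map id (2 * · + 1) ∘ ν.symm,
    inj fun _ _ => by simp, inj fun _ _ => by simp, fun a => ⟨?_, ?_⟩⟩
  all_goals
    funext n
    obtain ⟨i | i, rfl⟩ := ν.surjective n <;>
      simp [ν, interleave_even, interleave_odd]

/-- The sequence with first entry `a` followed by the entries of `e`. -/
def cons {α : Type*} (a : α) (e : ℕ → α) : ℕ → α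
  | 0 => a
  | n + 1 => e n

theorem cons_comp_succ (a : α) (e : ℕ → α) : cons a e ∘ Nat.succ = e := rfl

theorem update_cons_zero (a b : α) (e : ℕ → α) : update (cons a e) 0 b = cons b e := by
  funext n; cases n <;> rfl

theorem update_interleave_cons (e p : ℕ → α) (a b : α) :
    update (interleave e (cons a p)) 1 b = interleave e (cons b p) := by
  rw [← update_cons_zero a b p, interleave, interleave, Sum.elim_update_right, update_comp_equiv]
  rfl

theorem exists_interleave_cons_comp : ∃ f g, Injective f ∧ Injective g ∧ 1 ∉ Set.range g ∧
    ∀ (e p : ℕ → α) (a : α), interleave e (cons a p) ∘ f = interleave (cons a e) p ∧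
      interleave e (cons a p) ∘ g = interleave e p := by
  let ν := natSumNatEquivNat
  let F : ℕ ⊕ ℕ → ℕ ⊕ ℕ := Sum.elim (cons (.inr 0) .inl) (.inr ∘ Nat.succ)
  have hF : Injective F := by
    rintro ((_ | i) | i) ((_ | j) | j) h <;> simp_all [F, cons]
  refine ⟨ν ∘ F ∘ ν.symm, ν ∘ Sum.map id Nat.succ ∘ ν.symm,
    ν.injective.comp (hF.comp ν.symm.injective),
    ν.injective.comp ((injective_id.sumMap Nat.succ_injective).comp ν.symm.injective), ?_,
    fun e p a => ⟨?_, ?_⟩⟩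
  · rintro ⟨n, hn⟩
    have : ν (Sum.map id Nat.succ (ν.symm n)) = ν (.inr 0) := hn
    cases h : ν.symm n <;> simp [h] at this
  all_goals
    funext n
    obtain ⟨(_ | i) | i, rfl⟩ := ν.surjective n <;>
      simp [ν, F, interleave, cons]

end Interleave

/-! ### Definability -/

/-- Functions of a sequence of numbers given by a term with parameters from `M`. -/
inductive TermDefinable : ((ℕ → M.N) → M.N) → Prop
  | var (i : ℕ) : TermDefinable fun e => e i
  | const (a : M.N) : TermDefinable fun _ => a
  | add {t s} : TermDefinable t → TermDefinable s → TermDefinable fun e => t e + s e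
  | mul {t s} : TermDefinable t → TermDefinable s → TermDefinable fun e => t e * s e
  | pow {t s} : TermDefinable t → TermDefinable s → TermDefinable fun e => t e ^ s e

/-- Relations on a sequence of numbers given by a `Σ⁰₀` formula with number and set parameters from
`M`. -/
inductive Sigma00Definable : ((ℕ → M.N) → Prop) → Prop
  | eq {t s} : TermDefinable t → TermDefinable s → Sigma00Definable fun e => t e = s e
  | lt {t s} : TermDefinable t → TermDefinable s → Sigma00Definable fun e => t e < s e
  | mem {t F} : TermDefinable t → F ∈ M.S → Sigma00Definable fun e => t e ∈ F
  | not {P} : Sigma00Definable P → Sigma00Definable fun e => ¬ P e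
  | and {P Q} : Sigma00Definable P → Sigma00Definable Q → Sigma00Definable fun e => P e ∧ Q e
  | ball {t} {Q : M.N → (ℕ → M.N) → Prop} : TermDefinable t →
      Sigma00Definable (fun e => Q (e 0) fun i => e (i + 1)) →
      Sigma00Definable fun e => ∀ a, a < t e → Q a e

namespace TermDefinable

variable {t s : (ℕ → M.N) → M.N}

theorem comp (ht : TermDefinable t) {u : ℕ → (ℕ → M.N) → M.N} (hu : ∀ i, TermDefinable (u i)) :
    TermDefinable fun e => t fun i => u i e := by
  induction ht with
  | var i => exact hu i
  | const a => exact .const a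
  | add _ _ ht hs => exact ht.add hs
  | mul _ _ ht hs => exact ht.mul hs
  | pow _ _ ht hs => exact ht.pow hs

theorem eval (τ : Tm) {u : ℕ → (ℕ → M.N) → M.N} (hu : ∀ i, TermDefinable (u i)) :
    TermDefinable fun e => M.eval (fun i => u i e) τ := by
  induction τ with
  | var i => exact hu i
  | zero => exact .const _
  | one => exact .const _
  | add _ _ ht hs => exact ht.add hs
  | mul _ _ ht hs => exact ht.mul hs
  | exp _ _ ht hs => exact ht.pow hs

theorem exists_common_parameters (ht : ∃ τ p, ∀ e, t e = M.eval (interleave e p) τ)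
    (hs : ∃ σ p, ∀ e, s e = M.eval (interleave e p) σ) :
    ∃ τ σ p, ∀ e, t e = M.eval (interleave e p) τ ∧ s e = M.eval (interleave e p) σ := by
  obtain ⟨τ, p, hτ⟩ := ht
  obtain ⟨σ, q, hσ⟩ := hs
  obtain ⟨f, g, -, -, h⟩ := exists_interleave_interleave_comp p q
  exact ⟨τ.rename f, σ.rename g, interleave p q, fun e => by
    simp only [eval_rename, (h e).1, (h e).2, hτ, hσ, and_self]⟩

theorem exists_tm (ht : TermDefinable t) : ∃ τ p, ∀ e, t e = M.eval (interleave e p) τ := by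
  induction ht with
  | var i => exact ⟨.var (2 * i), fun _ => 0, fun e => (interleave_even e _ i).symm⟩
  | const a => exact ⟨.var 1, fun _ => a, fun e => (interleave_odd e (fun _ => a) 0).symm⟩
  | add _ _ ht hs =>
    obtain ⟨τ, σ, p, h⟩ := exists_common_parameters ht hs
    exact ⟨.add τ σ, p, fun e => congrArg₂ (· + ·) (h e).1 (h e).2⟩
  | mul _ _ ht hs =>
    obtain ⟨τ, σ, p, h⟩ := exists_common_parameters ht hs
    exact ⟨.mul τ σ, p, fun e => congrArg₂ (· * ·) (h e).1 (h e).2⟩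
  | pow _ _ ht hs =>
    obtain ⟨τ, σ, p, h⟩ := exists_common_parameters ht hs
    exact ⟨.exp τ σ, p, fun e => congrArg₂ (· ^ ·) (h e).1 (h e).2⟩

end TermDefinable

namespace Sigma00Definable

variable {P Q : (ℕ → M.N) → Prop}

theorem of_iff (hQ : Sigma00Definable Q) (h : ∀ e, P e ↔ Q e) : Sigma00Definable P := by
  rwa [funext fun e => propext (h e)]

theorem or (hP : Sigma00Definable P) (hQ : Sigma00Definable Q) :
    Sigma00Definable fun e => P e ∨ Q e :=
  (hP.not.and hQ.not).not.of_iff fun _ => or_iff_not_and_not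

theorem imp (hP : Sigma00Definable P) (hQ : Sigma00Definable Q) :
    Sigma00Definable fun e => P e → Q e :=
  (hP.not.or hQ).of_iff fun _ => imp_iff_not_or

theorem bex {t : (ℕ → M.N) → M.N} {Q : M.N → (ℕ → M.N) → Prop} (ht : TermDefinable t)
    (hQ : Sigma00Definable fun e => Q (e 0) fun i => e (i + 1)) :
    Sigma00Definable fun e => ∃ a, a < t e ∧ Q a e :=
  (ball (Q := fun a e => ¬ Q a e) ht hQ.not).not.of_iff fun _ => by push Not; rfl

theorem comp (hP : Sigma00Definable P) {u : ℕ → (ℕ → M.N) → M.N}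
    (hu : ∀ i, TermDefinable (u i)) : Sigma00Definable fun e => P fun i => u i e := by
  induction hP generalizing u with
  | eq ht hs => exact .eq (ht.comp hu) (hs.comp hu)
  | lt ht hs => exact .lt (ht.comp hu) (hs.comp hu)
  | mem ht hF => exact .mem (ht.comp hu) hF
  | not _ ih => exact (ih hu).not
  | and _ _ ih₁ ih₂ => exact (ih₁ hu).and (ih₂ hu)
  | ball ht _ ih =>
    refine .ball (ht.comp hu) (ih (u := cons (fun e => e 0) fun i e => u i fun j => e (j + 1)) ?_)
    rintro (_ | i)
    exacts [.var 0, (hu i).comp fun j => .var (j + 1)]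

theorem comp₂ {R : M.N → M.N → Prop} (hR : Sigma00Definable fun e : ℕ → M.N => R (e 0) (e 1))
    {t s : (ℕ → M.N) → M.N} (ht : TermDefinable t) (hs : TermDefinable s) :
    Sigma00Definable fun e => R (t e) (s e) :=
  hR.comp (u := cons t (cons s fun i e => e i)) (by
    rintro (_ | _ | i)
    exacts [ht, hs, .var i])

theorem comp₃ {R : M.N → M.N → M.N → Prop}
    (hR : Sigma00Definable fun e : ℕ → M.N => R (e 0) (e 1) (e 2))
    {t s r : (ℕ → M.N) → M.N} (ht : TermDefinable t) (hs : TermDefinable s)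
    (hr : TermDefinable r) : Sigma00Definable fun e => R (t e) (s e) (r e) :=
  hR.comp (u := cons t (cons s (cons r fun i e => e i))) (by
    rintro (_ | _ | _ | i)
    exacts [ht, hs, hr, .var i])

theorem sat {θ : Fml} (hθ : θ.IsSigma00) {E : ℕ → Set M.N} (hE : ∀ X, E X ∈ M.S)
    {u : ℕ → (ℕ → M.N) → M.N} (hu : ∀ i, TermDefinable (u i)) :
    Sigma00Definable fun e => M.Sat θ (fun i => u i e) E := by
  have hcons (x : ℕ) {u : ℕ → (ℕ → M.N) → M.N} (hu : ∀ i, TermDefinable (u i)) :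
      ∀ i, TermDefinable fun e => update (fun i => u i fun j => e (j + 1)) x (e 0) i := fun i => by
    by_cases hi : i = x
    · subst hi; simpa using .var 0
    · simpa [hi] using (hu i).comp fun j => .var (j + 1)
  induction hθ generalizing u with
  | eq τ σ => exact .eq (.eval τ hu) (.eval σ hu)
  | lt τ σ => exact .lt (.eval τ hu) (.eval σ hu)
  | mem τ X => exact .mem (.eval τ hu) (hE X)
  | neg _ ih => exact (ih hu).not
  | and _ _ ih₁ ih₂ => exact (ih₁ hu).and (ih₂ hu)
  | or _ _ ih₁ ih₂ => exact (ih₁ hu).or (ih₂ hu)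
  | imp _ _ ih₁ ih₂ => exact (ih₁ hu).imp (ih₂ hu)
  | @ball φ x τ hx _ ih =>
    refine (ball (Q := fun a e => M.Sat φ (update (fun i => u i e) x a) E) (.eval τ hu)
      (ih (hcons x hu))).of_iff fun e => ?_
    simp only [Sat, eval, update_self, eval_update_of_not_occurs hx]
    rfl
  | @bex φ x τ hx _ ih =>
    refine (bex (Q := fun a e => M.Sat φ (update (fun i => u i e) x a) E) (.eval τ hu)
      (ih (hcons x hu))).of_iff fun e => ?_
    simp only [Sat, eval, update_self, eval_update_of_not_occurs hx]
    rfl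

theorem exists_sat_and_iff {θ η : Fml} (hθ : θ.IsSigma00) (hη : η.IsSigma00) (p q : ℕ → M.N)
    (A B : ℕ → Set M.N) : ∃ (ξ : Fml) (r : ℕ → M.N), ξ.IsSigma00 ∧ ∀ e,
      M.Sat ξ (interleave e r) (interleave A B) ↔
        M.Sat θ (interleave e p) A ∧ M.Sat η (interleave e q) B := by
  obtain ⟨f, g, hf, hg, hfg⟩ := exists_interleave_interleave_comp p q
  have heven : Injective (2 * · : ℕ → ℕ) := fun _ _ => by simp
  have hodd : Injective (2 * · + 1 : ℕ → ℕ) := fun _ _ => by simp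
  have hA : interleave A B ∘ (2 * ·) = A := funext (interleave_even A B)
  have hB : interleave A B ∘ (2 * · + 1) = B := funext (interleave_odd A B)
  refine ⟨.and (θ.rename f (2 * ·)) (η.rename g (2 * · + 1)), interleave p q,
    (hθ.rename hf).and (hη.rename hg), fun e => ?_⟩
  simp only [Sat, sat_rename hf heven, sat_rename hg hodd, hfg, hA, hB]

theorem exists_sat_ball_iff (τ : Tm) {θ : Fml} (hθ : θ.IsSigma00) (p q : ℕ → M.N) :
    ∃ (ξ : Fml) (r : ℕ → M.N), ξ.IsSigma00 ∧ ∀ e A, M.Sat ξ (interleave e r) A ↔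
      ∀ a, a < M.eval (interleave e p) τ → M.Sat θ (interleave (cons a e) q) A := by
  obtain ⟨f, g, -, hg, hfg⟩ := exists_interleave_interleave_comp p q
  obtain ⟨f', g', hf', -, hg', hfg'⟩ := exists_interleave_cons_comp (α := M.N)
  refine ⟨_, cons 0 (interleave p q), .ball 1 ((τ.rename f).rename g') ?_
    ((hθ.rename (g := id) hg).rename (g := id) hf'), fun e A => forall_congr' fun a => ?_⟩
  · rw [Tm.occurs_rename]
    exact fun ⟨y, _, hy⟩ => hg' ⟨y, hy⟩
  · have hvar : interleave e (cons a (interleave p q)) 1 = a := interleave_odd e (cons a _) 0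
    simp only [Sat, eval, update_interleave_cons, eval_rename, sat_rename hf' injective_id,
      sat_rename hg injective_id, hfg', hfg, comp_id, hvar]
    rfl

theorem exists_fml (hP : Sigma00Definable P) : ∃ (θ : Fml) (p : ℕ → M.N) (A : ℕ → Set M.N),
    θ.IsSigma00 ∧ (∀ X, A X ∈ M.S) ∧ ∀ e, P e ↔ M.Sat θ (interleave e p) A := by
  obtain ⟨F₀, hF₀⟩ := M.S_nonempty
  induction hP with
  | eq ht hs =>
    obtain ⟨τ, σ, p, h⟩ := TermDefinable.exists_common_parameters ht.exists_tm hs.exists_tm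
    exact ⟨.eq τ σ, p, fun _ => F₀, .eq _ _, fun _ => hF₀, fun e => by
      simp only [Sat, (h e).1, (h e).2]⟩
  | lt ht hs =>
    obtain ⟨τ, σ, p, h⟩ := TermDefinable.exists_common_parameters ht.exists_tm hs.exists_tm
    exact ⟨.lt τ σ, p, fun _ => F₀, .lt _ _, fun _ => hF₀, fun e => by
      simp only [Sat, (h e).1, (h e).2]; rfl⟩
  | @mem _ F ht hF =>
    obtain ⟨τ, p, hτ⟩ := ht.exists_tm
    exact ⟨.mem τ 0, p, fun _ => F, .mem _ _, fun _ => hF, fun e => by simp only [Sat, hτ]⟩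
  | not _ ih =>
    obtain ⟨θ, p, A, hθ, hA, h⟩ := ih
    exact ⟨θ.neg, p, A, hθ.neg, hA, fun e => not_congr (h e)⟩
  | and _ _ ih₁ ih₂ =>
    obtain ⟨θ, p, A, hθ, hA, h⟩ := ih₁
    obtain ⟨η, q, B, hη, hB, h'⟩ := ih₂
    obtain ⟨ξ, r, hξ, hr⟩ := exists_sat_and_iff hθ hη p q A B
    exact ⟨ξ, r, interleave A B, hξ, interleave_mem hA hB, fun e => by simp only [h, h', hr]⟩
  | ball ht _ ih =>
    obtain ⟨τ, p, hτ⟩ := ht.exists_tm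
    obtain ⟨θ, q, A, hθ, hA, h⟩ := ih
    obtain ⟨ξ, r, hξ, hr⟩ := exists_sat_ball_iff τ hθ p q
    exact ⟨ξ, r, A, hξ, hA, fun e => by simp only [hτ, hr, ← h, cons]⟩

end Sigma00Definable

/-- The code `(m + n)² + m` of the pair `(m, n)`. -/
def pairCode (m n : M.N) : M.N :=
  (m + n) * (m + n) + m

theorem TermDefinable.pairCode {t s : (ℕ → M.N) → M.N} (ht : TermDefinable t)
    (hs : TermDefinable s) : TermDefinable fun e => pairCode (t e) (s e) :=
  ((ht.add hs).mul (ht.add hs)).add ht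

/-! ### The principle `ECT` -/

/-- The set `F` is the graph of a function from the numbers to the numbers below `k`. -/
structure IsColoring (F : Set M.N) (k : M.N) : Prop where
  exists_eq_pairCode : ∀ z, z ∈ F → ∃ x y, y < k ∧ z = pairCode x y
  total : ∀ x, ∃ y, pairCode x y ∈ F
  unique : ∀ x y y', pairCode x y ∈ F → pairCode x y' ∈ F → y = y'

theorem isColoring_iff {F : Set M.N} {k : M.N} : IsColoring F k ↔
    (∀ z, z ∈ F → ∃ x y, y < k ∧ z = pairCode x y) ∧ (∀ x, ∃ y, pairCode x y ∈ F) ∧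
      ∀ x y y', pairCode x y ∈ F → pairCode x y' ∈ F → y = y' :=
  ⟨fun h => ⟨h.1, h.2, h.3⟩, fun h => ⟨h.1, h.2.1, h.2.2⟩⟩

/-- The meaning of the formula `ECT` in the structure `M`. -/
def ECTHolds (M : L2Structure.{u}) : Prop :=
  ∀ k : M.N, ∀ F ∈ M.S, IsColoring F k →
    ∃ b, ∀ x, b ≤ x → ∃ y, x < y ∧ ∃ j, pairCode x j ∈ F ∧ pairCode y j ∈ F

theorem isTrue_ECT_iff : M.IsTrue ECT ↔ M.ECTHolds := by
  have h (e : ℕ → M.N) (E : ℕ → Set M.N) : M.Sat ECT e E ↔ M.ECTHolds := by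
    simp only [ECT, isColoring, pair, Fml.le, Sat, update_self, eval, ne_eq, OfNat.zero_ne_ofNat,
      not_false_eq_true, update_of_ne, Nat.reduceEqDiff, and_imp, OfNat.one_ne_ofNat, ECTHolds,
      isColoring_iff]
    rfl
  obtain ⟨A, hA⟩ := M.S_nonempty
  exact ⟨fun H => (h _ _).1 (H 0 (fun _ => A) fun _ => hA), fun H e E _ => (h e E).2 H⟩

/-! ### The axiom schemes -/

theorem sigma02_induction (hI : M.IsModel ISigma02) {R : M.N → M.N → M.N → Prop}
    (definable : Sigma00Definable fun e : ℕ → M.N => R (e 0) (e 1) (e 2))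
    (zero : ∃ x, ∀ y, R 0 x y)
    (succ : ∀ n, (∃ x, ∀ y, R n x y) → ∃ x, ∀ y, R (n + 1) x y) (n : M.N) : ∃ x, ∀ y, R n x y := by
  obtain ⟨θ, p, A, hθ, hA, h⟩ := definable.exists_fml
  have hsat (a x y : M.N) :
      M.Sat θ (update (update (update (interleave 0 p) (2 * 0) a) (2 * 1) x) (2 * 2) y) A ↔
        R a x y := by
    rw [← interleave_update, ← interleave_update, ← interleave_update, ← h]
    simp
  have hind := hI _ ⟨2 * 0, _, ⟨2 * 1, 2 * 2, θ, hθ, rfl⟩, rfl⟩ (interleave 0 p) A hA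
  simp only [sat_inductionAxiom, Sat, hsat] at hind
  exact hind zero succ n

section RCA0Star

variable [hM : Fact (M.IsModel RCA0Star)] {P : M.N → Prop}

@[elab_as_elim]
theorem sigma00_induction (definable : Sigma00Definable fun e : ℕ → M.N => P (e 0)) (zero : P 0)
    (succ : ∀ n, P n → P (n + 1)) (n : M.N) : P n := by
  obtain ⟨θ, p, A, hθ, hA, h⟩ := definable.exists_fml
  have hsat (a : M.N) : M.Sat θ (update (interleave 0 p) 0 a) A ↔ P a := by
    rw [← mul_zero 2, ← interleave_update, ← h, update_self]
  have hind := hM.out _ (.inl (.inr ⟨0, θ, hθ, rfl⟩)) (interleave 0 p) A hA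
  simp only [sat_inductionAxiom, hsat] at hind
  exact hind zero succ n

theorem sigma00_comprehension (definable : Sigma00Definable fun e : ℕ → M.N => P (e 0)) :
    {a | P a} ∈ M.S := by
  obtain ⟨θ, p, A, hθ, hA, h⟩ := definable.exists_fml
  -- Renaming `θ` by `Nat.succ` leaves the number variable `0` free for a dummy quantifier, and the
  -- set variable `0` for the comprehended set.
  have hsat (a c : M.N) (F : Set M.N) : M.Sat (θ.rename Nat.succ Nat.succ)
      (update (update (cons 0 (interleave 0 p)) 1 a) 0 c) (cons F A) ↔ P a := by
    have he : update (update (cons 0 (interleave 0 p)) 1 a) 0 c ∘ Nat.succ =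
        interleave (update 0 0 a) p := by
      rw [interleave_update]
      funext n
      simp [update_apply, cons]
    rw [sat_rename Nat.succ_injective Nat.succ_injective, he, cons_comp_succ, ← h, update_self]
  have hθ' := hθ.rename (g := Nat.succ) Nat.succ_injective
  have hcomp := hM.out _ (.inr ⟨1, 0, _, _, ⟨0, _, hθ', rfl⟩, ⟨0, _, hθ', rfl⟩,
    Fml.not_freeSet_rename (by simp) θ, rfl⟩) (cons 0 (interleave 0 p)) (cons (A 0) A)
    (by rintro (_ | X) <;> exact hA _)
  simp only [Fml.iff, Sat, eval, update_cons_zero, hsat, update_self, cons, exists_const,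
    forall_const] at hcomp
  obtain ⟨F, hF, hiff⟩ := hcomp fun a => ⟨id, id⟩
  rwa [show {a | P a} = F from Set.ext fun a => ⟨(hiff a).2, (hiff a).1⟩]

/-! ### Arithmetic -/

theorem sat_of_mem_basicAxioms {φ : Fml} (hφ : φ ∈ basicAxioms) (m n : M.N) :
    M.Sat φ (cons m fun _ => n) fun _ => M.S_nonempty.some :=
  hM.out φ (.inl (.inl (.inl hφ))) _ _ fun _ => M.S_nonempty.some_mem

theorem sat_of_mem_expAxioms {φ : Fml} (hφ : φ ∈ expAxioms) (m n : M.N) :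
    M.Sat φ (cons m fun _ => n) fun _ => M.S_nonempty.some :=
  hM.out φ (.inl (.inl (.inr hφ))) _ _ fun _ => M.S_nonempty.some_mem

protected theorem add_one_ne_zero (n : M.N) : n + 1 ≠ 0 :=
  sat_of_mem_basicAxioms (.inl rfl) n n

protected theorem add_one_injective {m n : M.N} : m + 1 = n + 1 → m = n :=
  sat_of_mem_basicAxioms (.inr (.inl rfl)) m n

protected theorem add_zero (m : M.N) : m + 0 = m :=
  sat_of_mem_basicAxioms (.inr (.inr (.inl rfl))) m m

protected theorem add_add_one (m n : M.N) : m + (n + 1) = m + n + 1 :=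
  sat_of_mem_basicAxioms (.inr (.inr (.inr (.inl rfl)))) m n

protected theorem mul_zero (m : M.N) : m * 0 = 0 :=
  sat_of_mem_basicAxioms (.inr (.inr (.inr (.inr (.inl rfl))))) m m

protected theorem mul_add_one (m n : M.N) : m * (n + 1) = m * n + m :=
  sat_of_mem_basicAxioms (.inr (.inr (.inr (.inr (.inr (.inl rfl)))))) m n

protected theorem not_lt_zero (m : M.N) : ¬ m < 0 :=
  sat_of_mem_basicAxioms (.inr (.inr (.inr (.inr (.inr (.inr (.inl rfl))))))) m m

protected theorem lt_add_one_iff {m n : M.N} : m < n + 1 ↔ m ≤ n := by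
  have h := sat_of_mem_basicAxioms (.inr (.inr (.inr (.inr (.inr (.inr (.inr rfl))))))) m n
  exact ⟨h.1, h.2⟩

protected theorem exp_zero (m : M.N) : m ^ (0 : M.N) = 1 :=
  sat_of_mem_expAxioms (.inl rfl) m m

protected theorem exp_add_one (m n : M.N) : m ^ (n + 1) = m ^ n * m :=
  sat_of_mem_expAxioms (.inr rfl) m n

protected theorem add_assoc (a b c : M.N) : a + b + c = a + (b + c) := by
  induction c using sigma00_induction with
  | definable => repeat' constructor
  | zero => simp only [L2Structure.add_zero]
  | succ n ih => simp only [L2Structure.add_add_one, ih]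

protected theorem zero_add (a : M.N) : 0 + a = a := by
  induction a using sigma00_induction with
  | definable => repeat' constructor
  | zero => rw [L2Structure.add_zero]
  | succ n ih => rw [L2Structure.add_add_one, ih]

protected theorem add_one_add (a b : M.N) : a + 1 + b = a + b + 1 := by
  induction b using sigma00_induction with
  | definable => repeat' constructor
  | zero => simp only [L2Structure.add_zero]
  | succ n ih => simp only [L2Structure.add_add_one, ih]

protected theorem add_comm (a b : M.N) : a + b = b + a := by
  induction b using sigma00_induction with
  | definable => repeat' constructor
  | zero => rw [L2Structure.add_zero, L2Structure.zero_add]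
  | succ n ih => rw [L2Structure.add_add_one, L2Structure.add_one_add, ih]

instance : AddCommMonoid M.N where
  add_assoc := L2Structure.add_assoc
  zero_add := L2Structure.zero_add
  add_zero := L2Structure.add_zero
  add_comm := L2Structure.add_comm
  nsmul := nsmulRec

protected theorem mul_add (a b c : M.N) : a * (b + c) = a * b + a * c := by
  induction c using sigma00_induction with
  | definable => repeat' constructor
  | zero => rw [L2Structure.mul_zero, add_zero, add_zero]
  | succ n ih => rw [← add_assoc, L2Structure.mul_add_one, L2Structure.mul_add_one, ih, add_assoc]

protected theorem mul_assoc (a b c : M.N) : a * b * c = a * (b * c) := by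
  induction c using sigma00_induction with
  | definable => repeat' constructor
  | zero => simp only [L2Structure.mul_zero]
  | succ n ih => rw [L2Structure.mul_add_one, L2Structure.mul_add_one, L2Structure.mul_add, ih]

protected theorem zero_mul (a : M.N) : 0 * a = 0 := by
  induction a using sigma00_induction with
  | definable => repeat' constructor
  | zero => rw [L2Structure.mul_zero]
  | succ n ih => rw [L2Structure.mul_add_one, ih, add_zero]

protected theorem add_one_mul (a b : M.N) : (a + 1) * b = a * b + b := by
  induction b using sigma00_induction with
  | definable => repeat' constructor
  | zero => simp only [L2Structure.mul_zero, add_zero]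
  | succ n ih => rw [L2Structure.mul_add_one, L2Structure.mul_add_one, ih]; ac_rfl

protected theorem mul_comm (a b : M.N) : a * b = b * a := by
  induction b using sigma00_induction with
  | definable => repeat' constructor
  | zero => rw [L2Structure.mul_zero, L2Structure.zero_mul]
  | succ n ih => rw [L2Structure.mul_add_one, L2Structure.add_one_mul, ih]

instance : CommSemiring M.N where
  left_distrib := L2Structure.mul_add
  right_distrib a b c := by simp only [L2Structure.mul_comm _ c, L2Structure.mul_add]
  zero_mul := L2Structure.zero_mul
  mul_zero := L2Structure.mul_zero
  mul_assoc := L2Structure.mul_assoc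
  one_mul a := by rw [← zero_add 1, L2Structure.add_one_mul, L2Structure.zero_mul, zero_add]
  mul_one a := by rw [← zero_add 1, L2Structure.mul_add_one, L2Structure.mul_zero, zero_add]
  mul_comm := L2Structure.mul_comm

theorem eq_zero_or_eq_add_one (n : M.N) : n = 0 ∨ ∃ m, n = m + 1 := by
  suffices n = 0 ∨ ∃ m, m < n ∧ n = m + 1 from this.imp_right fun ⟨m, _, hm⟩ => ⟨m, hm⟩
  induction n using sigma00_induction with
  | definable => exact .or (.eq (.var 0) (.const 0)) (.bex (.var 0) (by repeat' constructor))
  | zero => exact .inl rfl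
  | succ n _ => exact .inr ⟨n, L2Structure.lt_add_one_iff.2 (.inr rfl), rfl⟩

theorem lt_add_add_one (m d : M.N) : m < m + (d + 1) := by
  induction d using sigma00_induction with
  | definable => repeat' constructor
  | zero => rw [zero_add, L2Structure.lt_add_one_iff]; exact .inr rfl
  | succ n ih => rw [← add_assoc, L2Structure.lt_add_one_iff]; exact .inl ih

theorem lt_iff_exists_add_one {m n : M.N} : m < n ↔ ∃ d, n = m + (d + 1) := by
  refine ⟨fun h => ?_, fun ⟨d, hd⟩ => hd ▸ lt_add_add_one m d⟩
  suffices ∃ d, d < n ∧ n = m + (d + 1) from this.imp fun _ => And.right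
  induction n using sigma00_induction with
  | definable =>
    exact .imp (.lt (.const m) (.var 0)) (.bex (.var 0) (by repeat' constructor))
  | zero => exact absurd h (L2Structure.not_lt_zero m)
  | succ n ih =>
    rcases L2Structure.lt_add_one_iff.1 h with hlt | rfl
    · obtain ⟨d, -, rfl⟩ := ih hlt
      refine ⟨d + 1, ?_, by ring⟩
      convert lt_add_add_one (d + 1) m using 1
      ring
    · refine ⟨0, ?_, by ring⟩
      convert lt_add_add_one 0 m using 1
      ring

protected theorem le_iff_exists_add {m n : M.N} : m ≤ n ↔ ∃ d, n = m + d := by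
  constructor
  · rintro (h | rfl)
    exacts [(lt_iff_exists_add_one.1 h).imp' _ fun _ => id, ⟨0, (add_zero m).symm⟩]
  · rintro ⟨d, rfl⟩
    obtain rfl | ⟨d, rfl⟩ := eq_zero_or_eq_add_one d
    exacts [.inr (add_zero m).symm, .inl (lt_add_add_one m d)]

protected theorem add_left_cancel (a : M.N) {b c : M.N} : a + b = a + c → b = c := by
  induction a using sigma00_induction with
  | definable => exact .imp (by repeat' constructor) (by repeat' constructor)
  | zero => simp only [zero_add, imp_self]
  | succ n ih =>
    simp only [add_right_comm n 1]
    exact fun h => ih (L2Structure.add_one_injective h)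

instance : IsCancelAdd M.N :=
  have : IsLeftCancelAdd M.N := ⟨fun a _ _ => L2Structure.add_left_cancel a⟩
  AddCommMagma.IsLeftCancelAdd.toIsCancelAdd M.N

protected theorem lt_irrefl (m : M.N) : ¬ m < m := fun h => by
  obtain ⟨d, hd⟩ := lt_iff_exists_add_one.1 h
  exact L2Structure.add_one_ne_zero d (left_eq_add.1 hd)

protected theorem lt_trans {a b c : M.N} (hab : a < b) (hbc : b < c) : a < c := by
  obtain ⟨d, rfl⟩ := lt_iff_exists_add_one.1 hab
  obtain ⟨d', rfl⟩ := lt_iff_exists_add_one.1 hbc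
  exact lt_iff_exists_add_one.2 ⟨d + 1 + d', by ring⟩

protected theorem le_total (a b : M.N) : a ≤ b ∨ b ≤ a := by
  induction a using sigma00_induction with
  | definable =>
    exact .or (.or (by repeat' constructor) (by repeat' constructor))
      (.or (by repeat' constructor) (by repeat' constructor))
  | zero => exact .inl (L2Structure.le_iff_exists_add.2 ⟨b, (zero_add b).symm⟩)
  | succ n ih =>
    rcases ih with (hlt | rfl) | hle
    · obtain ⟨d, rfl⟩ := lt_iff_exists_add_one.1 hlt
      exact .inl (L2Structure.le_iff_exists_add.2 ⟨d, by ring⟩)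
    · exact .inr (.inl (L2Structure.lt_add_one_iff.2 (.inr rfl)))
    · exact .inr (.inl (L2Structure.lt_add_one_iff.2 hle))

noncomputable instance : LinearOrder M.N where
  le_refl _ := .inr rfl
  le_trans
    | a, b, _, .inl hab, .inl hbc => .inl (L2Structure.lt_trans hab hbc)
    | _, _, _, .inl hab, .inr rfl => .inl hab
    | _, _, _, .inr rfl, hbc => hbc
  lt_iff_le_not_ge a b := by
    refine ⟨fun h => ⟨.inl h, ?_⟩, fun ⟨h, hn⟩ => h.resolve_right fun hab => hn (.inr hab.symm)⟩
    rintro (h' | rfl)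
    exacts [L2Structure.lt_irrefl _ (L2Structure.lt_trans h h'), L2Structure.lt_irrefl _ h]
  le_antisymm
    | _, _, .inr hab, _ => hab
    | _, _, _, .inr hba => hba.symm
    | _, _, .inl hab, .inl hba => absurd (L2Structure.lt_trans hab hba) (L2Structure.lt_irrefl _)
  le_total := L2Structure.le_total
  toDecidableLE := Classical.decRel _

instance : CanonicallyOrderedAdd M.N where
  exists_add_of_le := L2Structure.le_iff_exists_add.1
  le_add_self a b := L2Structure.le_iff_exists_add.2 ⟨b, add_comm b a⟩
  le_self_add _ b := L2Structure.le_iff_exists_add.2 ⟨b, rfl⟩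

noncomputable instance : SuccAddOrder M.N where
  __ := SuccOrder.ofSuccLeIff (· + 1) fun {a b} => by
    rw [← not_lt, L2Structure.lt_add_one_iff, not_le]
  succ_eq_add_one _ := rfl

instance : PosMulStrictMono M.N where
  mul_lt_mul_of_pos_left a ha b c hbc := by
    obtain ⟨a, rfl⟩ := lt_iff_exists_add_one.1 ha
    obtain ⟨d, rfl⟩ := lt_iff_exists_add_one.1 hbc
    exact lt_iff_exists_add_one.2 ⟨a * d + a + d, by ring⟩

instance : IsStrictOrderedRing M.N where
  add_le_add_left _ _ hab c := by
    obtain ⟨d, rfl⟩ := L2Structure.le_iff_exists_add.1 hab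
    exact L2Structure.le_iff_exists_add.2 ⟨d, by ring⟩
  le_of_add_le_add_left a b c habc := by
    obtain ⟨d, hd⟩ := L2Structure.le_iff_exists_add.1 habc
    exact L2Structure.le_iff_exists_add.2 ⟨d, add_left_cancel (hd.trans (add_assoc a b d))⟩
  zero_le_one := zero_le
  exists_pair_ne := ⟨0 + 1, 0, L2Structure.add_one_ne_zero 0⟩
  __ := (PosMulStrictMono.toMulPosStrictMono : MulPosStrictMono M.N)

protected theorem exp_add (a m n : M.N) : a ^ (m + n) = a ^ m * a ^ n := by
  induction n using sigma00_induction with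
  | definable => repeat' constructor
  | zero => rw [add_zero, L2Structure.exp_zero, mul_one]
  | succ n ih => rw [← add_assoc, L2Structure.exp_add_one, ih, L2Structure.exp_add_one, mul_assoc]

theorem two_pow_add_one (n : M.N) : (2 : M.N) ^ (n + 1) = 2 ^ n + 2 ^ n := by
  rw [L2Structure.exp_add_one, mul_two]

theorem two_pow_pos (n : M.N) : (0 : M.N) < 2 ^ n := by
  induction n using sigma00_induction with
  | definable => repeat' constructor
  | zero => rw [L2Structure.exp_zero]; exact one_pos
  | succ n ih => rw [L2Structure.exp_add_one]; exact mul_pos ih two_pos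

/-! ### Extremal elements of `Σ⁰₀` sets -/

namespace Sigma00Definable

variable {t s : (ℕ → M.N) → M.N} {Q : M.N → (ℕ → M.N) → Prop}

theorem le (ht : TermDefinable t) (hs : TermDefinable s) : Sigma00Definable fun e => t e ≤ s e :=
  (lt hs ht).not.of_iff fun _ => not_lt.symm

theorem ball_le (ht : TermDefinable t) (hQ : Sigma00Definable fun e => Q (e 0) fun i => e (i + 1)) :
    Sigma00Definable fun e => ∀ a, a ≤ t e → Q a e :=
  (ball (ht.add (.const 1)) hQ).of_iff fun _ => by simp only [Order.lt_add_one_iff]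

theorem bex_le (ht : TermDefinable t) (hQ : Sigma00Definable fun e => Q (e 0) fun i => e (i + 1)) :
    Sigma00Definable fun e => ∃ a, a ≤ t e ∧ Q a e :=
  (bex (ht.add (.const 1)) hQ).of_iff fun _ => by simp only [Order.lt_add_one_iff]

theorem isLeast (ht : TermDefinable t) (hQ : Sigma00Definable fun e => Q (e 0) fun i => e (i + 1)) :
    Sigma00Definable fun e => IsLeast {a | Q a e} (t e) := by
  have hQt : Sigma00Definable fun e => Q (t e) e :=
    hQ.comp (u := cons t fun i e => e i) (by rintro (_ | i); exacts [ht, .var i])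
  refine (hQt.and (ball (Q := fun a e => ¬ Q a e) ht hQ.not)).of_iff fun e =>
    and_congr_right fun _ => forall_congr' fun a => ?_
  rw [← not_lt]
  exact imp_not_comm

end Sigma00Definable

theorem exists_isLeast (hP : Sigma00Definable fun e : ℕ → M.N => P (e 0)) (hne : ∃ a, P a) :
    ∃ a, IsLeast {a | P a} a := by
  by_contra! h
  have not_of_lt (n : M.N) : ∀ a, a < n → ¬ P a := by
    induction n using sigma00_induction with
    | definable => exact .ball (.var 0) (hP.comp fun _ => .var 0).not
    | zero => exact fun a ha => absurd ha not_lt_zero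
    | succ n ih =>
      intro a ha hPa
      obtain rfl : a = n := (Order.lt_add_one_iff.1 ha).eq_of_not_lt fun hlt => ih a hlt hPa
      exact h a ⟨hPa, fun b hPb => not_lt.1 fun hlt => ih b hlt hPb⟩
  obtain ⟨a, ha⟩ := hne
  exact not_of_lt (a + 1) a (lt_add_one a) ha

theorem exists_isGreatest (hP : Sigma00Definable fun e : ℕ → M.N => P (e 0)) (hne : ∃ a, P a)
    (hbdd : BddAbove {a | P a}) : ∃ a, IsGreatest {a | P a} a := by
  obtain ⟨b, hb⟩ := hbdd
  obtain ⟨a, ha⟩ := hne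
  obtain ⟨d, hd⟩ := exists_add_of_le (hb ha)
  obtain ⟨d, ⟨m, -, hm, hmd⟩, hleast⟩ := exists_isLeast
    (P := fun d => ∃ m, m ≤ b ∧ P m ∧ b = m + d)
    (.bex_le (.const b) ((hP.comp fun _ => .var 0).and (by repeat' constructor)))
    ⟨d, a, hb ha, ha, hd⟩
  refine ⟨m, hm, fun x hx => ?_⟩
  obtain ⟨c, hc⟩ := exists_add_of_le (hb hx)
  have hdc : d ≤ c := hleast ⟨x, hb hx, hx, hc⟩
  exact le_of_add_le_add_right (a := d) ((add_le_add_right hdc x).trans_eq (hc.symm.trans hmd))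

/-! ### Pairs -/

theorem le_pairCode_left (m n : M.N) : m ≤ pairCode m n :=
  le_add_self

theorem le_pairCode_right (m n : M.N) : n ≤ pairCode m n := by
  have hmul : m + n ≤ (m + n) * (m + n) := by
    obtain h | ⟨d, h⟩ := eq_zero_or_eq_add_one (m + n)
    · simp [h]
    · rw [h]; exact le_mul_of_one_le_right zero_le le_add_self
  exact le_add_self.trans (hmul.trans le_self_add)

theorem pairCode_lt_pairCode_of_add_lt {m n m' n' : M.N} (h : m + n < m' + n') :
    pairCode m n < pairCode m' n' :=
  calc
    (m + n) * (m + n) + m < (m + n) * (m + n) + m + (m + n + n + 1) :=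
      lt_add_add_one _ _
    _ = (m + n + 1) * (m + n + 1) := by ring
    _ ≤ (m' + n') * (m' + n') := mul_self_le_mul_self zero_le (Order.add_one_le_of_lt h)
    _ ≤ (m' + n') * (m' + n') + m' := le_self_add

theorem pairCode_inj {m n m' n' : M.N} : pairCode m n = pairCode m' n' ↔ m = m' ∧ n = n' := by
  refine ⟨fun h => ?_, fun ⟨hm, hn⟩ => by rw [hm, hn]⟩
  rcases lt_trichotomy (m + n) (m' + n') with hlt | heq | hgt
  · exact absurd h (pairCode_lt_pairCode_of_add_lt hlt).ne
  · rw [pairCode, pairCode, heq] at h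
    obtain rfl := add_left_cancel h
    exact ⟨rfl, add_left_cancel heq⟩
  · exact absurd h (pairCode_lt_pairCode_of_add_lt hgt).ne'

/-! ### From `Σ⁰₂` induction to `ECT` -/

theorem sigma02_induction₂ (hI : M.IsModel ISigma02) {R : M.N → M.N → M.N → M.N → Prop}
    (definable : Sigma00Definable fun e : ℕ → M.N => R (e 0) (e 1) (e 2) (e 3))
    (zero : ∃ x y, ∀ z, R 0 x y z)
    (succ : ∀ n, (∃ x y, ∀ z, R n x y z) → ∃ x y, ∀ z, R (n + 1) x y z) (n : M.N) :
    ∃ x y, ∀ z, R n x y z := by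
  let R' (n p z : M.N) : Prop := ∃ x, x ≤ p ∧ ∃ y, y ≤ p ∧ p = pairCode x y ∧ R n x y z
  have hR' (n : M.N) : (∃ p, ∀ z, R' n p z) ↔ ∃ x y, ∀ z, R n x y z := by
    constructor
    · rintro ⟨p, hp⟩
      obtain ⟨x, -, y, -, rfl, -⟩ := hp 0
      refine ⟨x, y, fun z => ?_⟩
      obtain ⟨x', -, y', -, hpair, hz⟩ := hp z
      obtain ⟨rfl, rfl⟩ := pairCode_inj.1 hpair
      exact hz
    · rintro ⟨x, y, h⟩
      exact ⟨pairCode x y, fun z =>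
        ⟨x, le_pairCode_left x y, y, le_pairCode_right x y, rfl, h z⟩⟩
  have definable' : Sigma00Definable fun e : ℕ → M.N => R' (e 0) (e 1) (e 2) :=
    .bex_le (.var 1) (.bex_le (.var 2) (.and (.eq (.var 3) (.pairCode (.var 1) (.var 0)))
      (definable.comp fun i => .var (cons 2 (cons 1 (cons 0 fun _ => 4)) i))))
  simp only [← hR'] at zero succ ⊢
  exact sigma02_induction hI definable' zero succ n

/-- The binary digit of `s` with place value `2 ^ j` is `0`. -/
def DigitZero (s j : M.N) : Prop :=
  ∃ q r, r < 2 ^ j ∧ s = q * 2 ^ (j + 1) + r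

theorem Sigma00Definable.digitZero {t s : (ℕ → M.N) → M.N} (ht : TermDefinable t)
    (hs : TermDefinable s) : Sigma00Definable fun e => DigitZero (t e) (s e) := by
  refine comp₂ (of_iff (Q := fun e => ∃ q, q ≤ e 0 ∧ ∃ r, r ≤ e 0 ∧
    r < 2 ^ e 1 ∧ e 0 = q * 2 ^ (e 1 + 1) + r) ?_ fun e => ⟨?_, ?_⟩) ht hs
  · exact .bex_le (.var 0) (.bex_le (.var 1) (by repeat' constructor))
  · rintro ⟨q, r, hr, h⟩
    have hq : q ≤ q * 2 ^ (e 1 + 1) :=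
      le_mul_of_one_le_right zero_le (Order.one_le_iff_pos.2 (two_pow_pos _))
    exact ⟨q, h ▸ hq.trans le_self_add, r, h ▸ le_add_self, hr, h⟩
  · rintro ⟨q, -, r, -, h⟩
    exact ⟨q, r, h⟩

namespace DigitZero

variable {s i j k : M.N}

theorem zero_left (j : M.N) : DigitZero 0 j :=
  ⟨0, 0, two_pow_pos j, by ring⟩

theorem add_two_pow_lt (h : DigitZero s j) (hs : s < 2 ^ k) (hj : j < k) : s + 2 ^ j < 2 ^ k := by
  obtain ⟨q, r, hr, rfl⟩ := h
  obtain ⟨d, rfl⟩ := exists_add_of_le (Order.add_one_le_of_lt hj)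
  have hq : q < 2 ^ d := by
    rw [L2Structure.exp_add 2 (j + 1), mul_comm q] at hs
    exact lt_of_mul_lt_mul_left (le_self_add.trans_lt hs) zero_le
  calc
    q * 2 ^ (j + 1) + r + 2 ^ j < q * 2 ^ (j + 1) + 2 ^ j + 2 ^ j := by gcongr
    _ = 2 ^ (j + 1) * (q + 1) := by rw [two_pow_add_one]; ring
    _ ≤ 2 ^ (j + 1) * 2 ^ d := by gcongr; exact Order.add_one_le_of_lt hq
    _ = 2 ^ (j + 1 + d) := (L2Structure.exp_add ..).symm

theorem of_mul_add {q : M.N} (h : DigitZero (q * 2 ^ (j + 1) + s) j) : DigitZero s j := by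
  obtain ⟨q', r, hr, h⟩ := h
  have hle : q ≤ q' := by
    by_contra! hlt
    refine h.not_gt ?_
    calc
      q' * 2 ^ (j + 1) + r < q' * 2 ^ (j + 1) + 2 ^ (j + 1) := by
        gcongr
        exact hr.trans_le (two_pow_add_one j ▸ le_self_add)
      _ = (q' + 1) * 2 ^ (j + 1) := by ring
      _ ≤ q * 2 ^ (j + 1) := by gcongr; exact Order.add_one_le_of_lt hlt
      _ ≤ q * 2 ^ (j + 1) + s := le_self_add
  obtain ⟨a, rfl⟩ := exists_add_of_le hle
  refine ⟨a, r, hr, add_left_cancel (h.trans ?_)⟩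
  ring

theorem add_two_pow (hi : DigitZero s i) (hj : DigitZero s j) (hij : i ≠ j) :
    DigitZero (s + 2 ^ j) i := by
  obtain ⟨q, r, hr, rfl⟩ := hi
  rcases hij.lt_or_gt with hlt | hgt
  · obtain ⟨d, rfl⟩ := exists_add_of_le (Order.add_one_le_of_lt hlt)
    exact ⟨q + 2 ^ d, r, hr, by
      rw [L2Structure.exp_add 2 (i + 1), add_mul, mul_comm (2 ^ d), add_right_comm]⟩
  · obtain ⟨d, rfl⟩ := exists_add_of_le (Order.add_one_le_of_lt hgt)
    rw [add_assoc (j + 1), L2Structure.exp_add, mul_comm (2 ^ (j + 1)), ← mul_assoc] at hj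
    refine ⟨q, r + 2 ^ j, hj.of_mul_add.add_two_pow_lt hr hgt, ?_⟩
    ring

end DigitZero

theorem IsColoring.lt {F : Set M.N} {k x y : M.N} (hF : IsColoring F k) (h : pairCode x y ∈ F) :
    y < k := by
  obtain ⟨x', y', hy', hpair⟩ := hF.exists_eq_pairCode _ h
  exact (pairCode_inj.1 hpair).2 ▸ hy'

theorem ectHolds_of_isModel_ISigma02 (hI : M.IsModel ISigma02) : M.ECTHolds := by
  intro k F hF hcol
  by_contra! hbad
  -- A digit `1` of `s` at the place `j` asserts that `j` is not a colour from `b` on.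
  let R (n b s x : M.N) : Prop :=
    n ≤ s ∧ s < 2 ^ k ∧ (b ≤ x → ∀ j, j < k → pairCode x j ∈ F → DigitZero s j)
  have definable : Sigma00Definable fun e : ℕ → M.N => R (e 0) (e 1) (e 2) (e 3) :=
    .and (.le (.var 0) (.var 2)) <| .and (by repeat' constructor) <|
      .imp (.le (.var 1) (.var 3)) <| .ball (.const k) <|
        .imp (.mem (.pairCode (.var 4) (.var 0)) hF) (.digitZero (.var 3) (.var 0))
  have zero : ∃ b s, ∀ x, R 0 b s x :=
    ⟨0, 0, fun _ => ⟨le_rfl, two_pow_pos k, fun _ j _ _ => .zero_left j⟩⟩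
  have succ (n : M.N) : (∃ b s, ∀ x, R n b s x) → ∃ b s, ∀ x, R (n + 1) b s x := by
    rintro ⟨b, s, h⟩
    obtain ⟨x, hbx, hx⟩ := hbad b
    obtain ⟨i, hi⟩ := hcol.total x
    have hik : i < k := hcol.lt hi
    obtain ⟨hns, hsk, hsi⟩ := h x
    replace hsi : DigitZero s i := hsi hbx i hik hi
    refine ⟨x + 1, s + 2 ^ i, fun y => ⟨add_le_add hns (Order.one_le_iff_pos.2 (two_pow_pos i)),
      hsi.add_two_pow_lt hsk hik, fun hxy j hjk hj => ?_⟩⟩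
    have hlt : x < y := Order.add_one_le_iff.1 hxy
    have hsj : DigitZero s j := (h y).2.2 (hbx.trans hlt.le) j hjk hj
    refine hsj.add_two_pow hsi ?_
    rintro rfl
    exact hx y hlt j hi hj
  obtain ⟨b, s, h⟩ := sigma02_induction₂ hI definable zero succ (2 ^ k)
  exact (h 0).1.not_gt (h 0).2.1

/-! ### From `ECT` to `Σ⁰₂` induction -/

theorem ECTHolds.eventually_frequently_eq (hect : M.ECTHolds) {f : M.N → M.N}
    (hf : Sigma00Definable fun e : ℕ → M.N => f (e 0) = e 1) {k : M.N} (hk : ∀ x, f x < k) :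
    ∀ᶠ x in atTop, ∃ᶠ y in atTop, f y = f x := by
  let F : Set M.N := {z | ∃ x, x ≤ z ∧ ∃ m, m ≤ z ∧ z = pairCode x m ∧ f x = m}
  have hF : F ∈ M.S := sigma00_comprehension <| .bex_le (.var 0) <| .bex_le (.var 1) <|
    .and (.eq (.var 2) (.pairCode (.var 1) (.var 0)))
      (hf.comp₂ (R := fun x m => f x = m) (.var 1) (.var 0))
  have mem_F (x m : M.N) : pairCode x m ∈ F ↔ f x = m := by
    refine ⟨?_, fun h => ⟨x, le_pairCode_left x m, m, le_pairCode_right x m, rfl, h⟩⟩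
    rintro ⟨x', -, m', -, hpair, h⟩
    rwa [(pairCode_inj.1 hpair).1, (pairCode_inj.1 hpair).2]
  have hcol : IsColoring F k := by
    refine ⟨?_, fun x => ⟨f x, (mem_F _ _).2 rfl⟩, fun x m m' h h' => ?_⟩
    · rintro _ ⟨x, -, _, -, rfl, rfl⟩
      exact ⟨x, f x, hk x, rfl⟩
    · exact ((mem_F _ _).1 h).symm.trans ((mem_F _ _).1 h')
  obtain ⟨b, hb⟩ := hect k F hF hcol
  filter_upwards [eventually_ge_atTop b] with x hbx hev
  obtain ⟨c, hc⟩ := eventually_atTop.1 hev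
  obtain ⟨y, hy, hmax⟩ := exists_isGreatest (P := fun y => f y = f x)
    (hf.comp₂ (R := fun x m => f x = m) (.var 0) (.const (f x))) ⟨x, rfl⟩
    ⟨c, fun y hy => le_of_not_ge fun hcy => hc y hcy hy⟩
  obtain ⟨y', hyy', j, hj, hj'⟩ := hb y (hbx.trans (hmax rfl))
  have hfy' : f y' = f y := ((mem_F _ _).1 hj').trans ((mem_F _ _).1 hj).symm
  exact (hmax (hfy'.trans hy)).not_gt hyy'

theorem ECTHolds.eventually_frequently_isLeast (hect : M.ECTHolds) {P : M.N → M.N → Prop}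
    (hP : Sigma00Definable fun e : ℕ → M.N => P (e 0) (e 1)) {k : M.N} (hk : ∀ x, P x k) :
    ∀ᶠ x in atTop, ∀ m, IsLeast {m | P x m} m → ∃ᶠ y in atTop, IsLeast {m | P y m} m := by
  choose f hf using fun x =>
    exists_isLeast (P := P x) (hP.comp₂ (.const x) (.var 0)) ⟨k, hk x⟩
  have graph : Sigma00Definable fun e : ℕ → M.N => f (e 0) = e 1 :=
    (Sigma00Definable.isLeast (Q := fun m e => P (e 0) m) (.var 1)
      (hP.comp₂ (.var 1) (.var 0))).of_iff fun e => ⟨fun h => h ▸ hf _, (hf _).unique⟩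
  have hfk (x : M.N) : f x < k + 1 := Order.lt_add_one_iff.2 ((hf x).2 (hk x))
  filter_upwards [hect.eventually_frequently_eq graph hfk] with x hx m hm
  refine hx.mono fun y hy => ?_
  rw [hm.unique (hf x), ← hy]
  exact hf y

theorem ECTHolds.exists_isLeast_pi01 (hect : M.ECTHolds) {R : M.N → M.N → Prop}
    (hR : Sigma00Definable fun e : ℕ → M.N => R (e 0) (e 1)) (hne : ∃ m, ∀ u, R m u) :
    ∃ m, IsLeast {m | ∀ u, R m u} m := by
  obtain ⟨k, hk⟩ := hne
  let P (x m : M.N) : Prop := ∀ u, u ≤ x → R m u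
  have hP : Sigma00Definable fun e : ℕ → M.N => P (e 0) (e 1) :=
    .ball_le (.var 0) (hR.comp₂ (.var 2) (.var 0))
  have hPk (x : M.N) : P x k := fun u _ => hk u
  obtain ⟨x, hx⟩ := (hect.eventually_frequently_isLeast hP hPk).exists
  obtain ⟨m, hm⟩ := exists_isLeast (P := P x) (hP.comp₂ (.const x) (.var 0)) ⟨k, hPk x⟩
  refine ⟨m, fun u => ?_, fun m' hm' => hm.2 fun u _ => hm' u⟩
  obtain ⟨y, huy, hy⟩ := frequently_atTop.1 (hx m hm) u
  exact hy.1 u huy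

theorem ECTHolds.exists_isLeast_sigma01 (hect : M.ECTHolds) {R : M.N → M.N → Prop}
    (hR : Sigma00Definable fun e : ℕ → M.N => R (e 0) (e 1)) (hne : ∃ m u, R m u) :
    ∃ m, IsLeast {m | ∃ u, R m u} m := by
  obtain ⟨k, hk⟩ := hne
  let P (x m : M.N) : Prop := m = k ∨ ∃ u, u ≤ x ∧ R m u
  have hP : Sigma00Definable fun e : ℕ → M.N => P (e 0) (e 1) :=
    .or (.eq (.var 1) (.const k)) (.bex_le (.var 0) (hR.comp₂ (.var 2) (.var 0)))
  have hPk (x : M.N) : P x k := .inl rfl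
  obtain ⟨x, hx⟩ := (hect.eventually_frequently_isLeast hP hPk).exists
  obtain ⟨m, hm⟩ := exists_isLeast (P := P x) (hP.comp₂ (.const x) (.var 0)) ⟨k, hPk x⟩
  refine ⟨m, ?_, fun m' ⟨u, hu⟩ => ?_⟩
  · rcases hm.1 with rfl | ⟨u, -, hu⟩
    exacts [hk, ⟨u, hu⟩]
  · obtain ⟨y, huy, hy⟩ := frequently_atTop.1 (hx m hm) u
    exact hy.2 (.inr ⟨u, huy, hu⟩)

theorem ECTHolds.bddAbove_isLeast_iff (hect : M.ECTHolds) {D : M.N → M.N → Prop}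
    (definable : Sigma00Definable fun e : ℕ → M.N => D (e 0) (e 1)) (hD : Antitone D)
    (hle : ∀ x u, D x u → x ≤ u) :
    BddAbove {u | ∃ x, IsLeast {u | D x u} u} ↔ ∃ x, ∀ u, ¬ D x u := by
  constructor
  · rintro ⟨b, hb⟩
    by_contra! h
    obtain ⟨u, hu⟩ := exists_isLeast (P := D (b + 1)) (definable.comp₂ (.const _) (.var 0)) (h _)
    exact (hb ⟨b + 1, hu⟩).not_gt (Order.add_one_le_iff.1 (hle _ _ hu.1))
  · intro h
    obtain ⟨x, hx, hmin⟩ := hect.exists_isLeast_pi01 definable.not h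
    obtain rfl | ⟨d, rfl⟩ := eq_zero_or_eq_add_one x
    · exact ⟨0, fun u ⟨x, hu⟩ => absurd (hD zero_le u hu.1) (hx u)⟩
    · obtain ⟨b, hb⟩ : ∃ b, D d b := by
        by_contra! hd
        exact (hmin hd).not_gt (lt_add_one d)
      refine ⟨b, fun u ⟨x, hu⟩ => hu.2 ?_⟩
      have hxd : x ≤ d := by
        by_contra! hdx
        exact hx u (hD (Order.add_one_le_of_lt hdx) u hu.1)
      exact hD hxd b hb

/-- The number `u` bounds `x` and counterexamples to each of the statements `∀ y, R x' y` with
`x' < x`. By bounding, such `u` exist for all `x` if and only if `∃ x, ∀ y, R x y` fails. -/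
def CounterexampleBound (R : M.N → M.N → Prop) (x u : M.N) : Prop :=
  x ≤ u ∧ ∀ x', x' < x → ∃ y, y < u ∧ ¬ R x' y

theorem CounterexampleBound.antitone (R : M.N → M.N → Prop) : Antitone (CounterexampleBound R) :=
  fun _ _ hle _ h => ⟨hle.trans h.1, fun x' hx' => h.2 x' (hx'.trans_le hle)⟩

theorem ECTHolds.exists_forall_not_counterexampleBound_iff (hect : M.ECTHolds)
    {R : M.N → M.N → Prop}
    (definable : Sigma00Definable fun e : ℕ → M.N => CounterexampleBound R (e 0) (e 1)) :
    (∃ x, ∀ u, ¬ CounterexampleBound R x u) ↔ ∃ x, ∀ y, R x y := by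
  constructor
  · intro h
    by_contra! hR
    obtain ⟨x, hx, hmin⟩ := hect.exists_isLeast_pi01 definable.not h
    obtain rfl | ⟨d, rfl⟩ := eq_zero_or_eq_add_one x
    · exact hx 0 ⟨le_rfl, fun x' hx' => absurd hx' not_lt_zero⟩
    · obtain ⟨u, hdu, hu⟩ : ∃ u, CounterexampleBound R d u := by
        by_contra! hd
        exact (hmin hd).not_gt (lt_add_one d)
      obtain ⟨y, hy⟩ := hR d
      refine hx (u + y + 1) ⟨add_le_add_left (hdu.trans le_self_add) 1, fun x' hx' => ?_⟩
      rcases (Order.lt_add_one_iff.1 hx').lt_or_eq with hlt | rfl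
      · obtain ⟨y', hy', hRy'⟩ := hu x' hlt
        exact ⟨y', hy'.trans_le (le_self_add.trans le_self_add), hRy'⟩
      · exact ⟨y, Order.lt_add_one_iff.2 le_add_self, hy⟩
  · rintro ⟨x, hx⟩
    refine ⟨x + 1, fun u hu => ?_⟩
    obtain ⟨y, -, hy⟩ := hu.2 x (lt_add_one x)
    exact hy (hx y)

theorem ECTHolds.exists_bddAbove_iff_sigma02 (hect : M.ECTHolds) {R : M.N → M.N → M.N → Prop}
    (hR : Sigma00Definable fun e : ℕ → M.N => R (e 0) (e 1) (e 2)) :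
    ∃ Q : M.N → M.N → Prop, Sigma00Definable (fun e : ℕ → M.N => Q (e 0) (e 1)) ∧
      ∀ n, BddAbove {u | Q n u} ↔ ∃ x, ∀ y, R n x y := by
  have definable {n x u : (ℕ → M.N) → M.N} (hn : TermDefinable n) (hx : TermDefinable x)
      (hu : TermDefinable u) :
      Sigma00Definable fun e => CounterexampleBound (R (n e)) (x e) (u e) := by
    refine .comp₃ (R := fun n => CounterexampleBound (R n)) ?_ hn hx hu
    exact .and (.le (.var 1) (.var 2)) <| .ball (.var 1) <| .bex (.var 3) <|
      (hR.comp₃ (.var 2) (.var 1) (.var 0)).not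
  refine ⟨fun n u => ∃ x, x ≤ u ∧ IsLeast {u | CounterexampleBound (R n) x u} u,
    .bex_le (.var 1) (.isLeast (.var 2) (definable (.var 2) (.var 1) (.var 0))), fun n => ?_⟩
  have hset : {u | ∃ x, x ≤ u ∧ IsLeast {u | CounterexampleBound (R n) x u} u} =
      {u | ∃ x, IsLeast {u | CounterexampleBound (R n) x u} u} :=
    Set.ext fun u => exists_congr fun x => and_iff_right_of_imp fun hu => hu.1.1
  have hdef := definable (.const n) (.var 0) (.var 1)
  rw [hset, hect.bddAbove_isLeast_iff hdef (.antitone _) fun x u hu => hu.1,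
    hect.exists_forall_not_counterexampleBound_iff hdef]

theorem ECTHolds.exists_isLeast_not_bddAbove (hect : M.ECTHolds) {Q : M.N → M.N → Prop}
    (hQ : Sigma00Definable fun e : ℕ → M.N => Q (e 0) (e 1)) (hne : ∃ m, ¬ BddAbove {u | Q m u}) :
    ∃ m, IsLeast {m | ¬ BddAbove {u | Q m u}} m := by
  obtain ⟨k, hk⟩ := hne
  -- The least `m` with `P z m` colours `z` by `m` if `z` codes a pair `(m, u)` with `m ≤ k` and
  -- `Q m u`, and by `k + 1` otherwise.
  let P (z m : M.N) : Prop := m = k + 1 ∨ ∃ u, u ≤ z ∧ z = pairCode m u ∧ Q m u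
  have hP : Sigma00Definable fun e : ℕ → M.N => P (e 0) (e 1) :=
    .or (by repeat' constructor) <| .bex_le (.var 0) <|
      .and (.eq (.var 1) (.pairCode (.var 2) (.var 0))) (hQ.comp₂ (.var 2) (.var 0))
  have isLeast_P {m u : M.N} (hmk : m ≤ k) (hmu : Q m u) :
      IsLeast {m' | P (pairCode m u) m'} m := by
    refine ⟨.inr ⟨u, le_pairCode_right m u, rfl, hmu⟩, ?_⟩
    rintro m' (rfl | ⟨u', -, hpair, -⟩)
    exacts [hmk.trans le_self_add, (pairCode_inj.1 hpair).1.le]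
  obtain ⟨b, hb⟩ := eventually_atTop.1
    (hect.eventually_frequently_isLeast hP (k := k + 1) fun _ => .inl rfl)
  have not_bddAbove_iff_exists {m : M.N} (hmk : m ≤ k) :
      ¬ BddAbove {u | Q m u} ↔ ∃ u, b ≤ pairCode m u ∧ Q m u := by
    constructor
    · intro h
      obtain ⟨u, hu, hbu⟩ := not_bddAbove_iff.1 h b
      exact ⟨u, hbu.le.trans (le_pairCode_right m u), hu⟩
    · rintro ⟨u, hbu, hu⟩ ⟨c, hc⟩
      obtain ⟨z, hcz, hz⟩ :=
        frequently_atTop.1 (hb _ hbu m (isLeast_P hmk hu)) (pairCode m (c + 1))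
      obtain rfl | ⟨v, -, rfl, hv⟩ := hz.1
      · exact hmk.not_gt (lt_add_one k)
      · exact hcz.not_gt (pairCode_lt_pairCode_of_add_lt
          (add_lt_add_right (Order.lt_add_one_iff.2 (hc hv)) m))
  have hk' := (not_bddAbove_iff_exists le_rfl).1 hk
  obtain ⟨m, hm, hmin⟩ := hect.exists_isLeast_sigma01 (R := fun m u => b ≤ pairCode m u ∧ Q m u)
    (.and (.le (.const b) (.pairCode (.var 0) (.var 1))) hQ) ⟨k, hk'⟩
  have hmk : m ≤ k := hmin hk'
  exact ⟨m, (not_bddAbove_iff_exists hmk).2 hm, fun m' hm' =>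
    (le_total m' k).elim (fun h => hmin ((not_bddAbove_iff_exists h).1 hm')) hmk.trans⟩

theorem ECTHolds.sigma02_induction (hect : M.ECTHolds) {R : M.N → M.N → M.N → Prop}
    (definable : Sigma00Definable fun e : ℕ → M.N => R (e 0) (e 1) (e 2))
    (zero : ∃ x, ∀ y, R 0 x y)
    (succ : ∀ n, (∃ x, ∀ y, R n x y) → ∃ x, ∀ y, R (n + 1) x y) (n : M.N) : ∃ x, ∀ y, R n x y := by
  obtain ⟨Q, hQ, hiff⟩ := hect.exists_bddAbove_iff_sigma02 definable
  simp only [← hiff] at zero succ ⊢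
  by_contra hn
  obtain ⟨m, hm, hmin⟩ := hect.exists_isLeast_not_bddAbove hQ ⟨n, hn⟩
  obtain rfl | ⟨d, rfl⟩ := eq_zero_or_eq_add_one m
  · exact hm zero
  · exact hm (succ d (by_contra fun hd => (hmin hd).not_gt (lt_add_one d)))

theorem ECTHolds.isModel_ISigma02 (hect : M.ECTHolds) : M.IsModel ISigma02 := by
  rintro _ ⟨z, _, ⟨x, y, θ, hθ, rfl⟩, rfl⟩ e E hE
  rw [sat_inductionAxiom]
  refine hect.sigma02_induction
    (R := fun n a b => M.Sat θ (update (update (update e z n) x a) y b) E) (.sat hθ hE fun i => ?_)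
  simp only [update_apply]
  split_ifs
  exacts [.var 2, .var 1, .var 0, .const (e i)]

end RCA0Star

end L2Structure

end SOA

theorem mainTheorem2 : SOA.EquivalentOver.{u} SOA.RCA0Star SOA.ISigma02 {SOA.ECT} := by
  constructor
  · rintro _ rfl M hM
    have : Fact (M.IsModel SOA.RCA0Star) := ⟨fun φ hφ => hM φ (.inl hφ)⟩
    exact SOA.L2Structure.isTrue_ECT_iff.2
      (SOA.L2Structure.ectHolds_of_isModel_ISigma02 fun φ hφ => hM φ (.inr hφ))
  · intro φ hφ M hM
    have : Fact (M.IsModel SOA.RCA0Star) := ⟨fun φ hφ => hM φ (.inl hφ)⟩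
    exact (SOA.L2Structure.isTrue_ECT_iff.1 (hM _ (.inr rfl))).isModel_ISigma02 φ hφ
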